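/- Let $\mathcal K^3$ be the set of compact convex subsets of $\mathbb R^3$ with non-empty interior, and let $V$ denote volume. For $K,L\in\mathcal K^3$ let the relative quermassintegrals $W_i(K,L)$, $i=0,1,2,3$, be the coefficients in the relative Steiner formula $$V(K+tL)=\sum_{i=0}^{3}\binom{3}{i}W_i(K,L)\,t^i\qquad(t\ge 0),$$ where $K+tL=\{x+ty: x\in K,\ y\in L\}$. For $i=0,1$ define the $i$-th relative Bonnesen function $$\mathcal B_{i;K,L}(r)=2W_{i+1}(K,L)\,r-W_i(K,L)-W_{i+2}(K,L)\,r^2 .$$ Further let $r_o(K,L)=\max\{t\ge 0: tL\subseteq K\}$ and $R_o(K,L)=\min\{t>0: K\subseteq tL\}$ whenever the origin $o$ lies in the interior of both $K$ and $L$. We say that $K$ is in the class $\mathfrak R_1$ (respectively, in the class $\mathfrak R_2$) with respect to $L$ if $o\in\operatorname{int}(K\cap L)$ and $\mathcal B_{0;K,L}(r)\ge 0$ (respectively, $\mathcal B_{1;K,L}(r)\ge 0$) for all $r\in[r_o(K,L),R_o(K,L)]$. Corollary 2.3. Let $K,L\in\mathcal K^3$. (i) If $K$ is in $\mathfrak R_1$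 with respect to $L$, then $L$ is in $\mathfrak R_2$ with respect to $K$. (ii) If $K$ is in $\mathfrak R_2$ with respect to $L$, then $L$ is in $\mathfrak R_1$ with respect to $K$. (iii) If $K$ is in both $\mathfrak R_1$ and $\mathfrak R_2$ with respect to $L$, then, for every $t\ge 0$, $K+tL$ is in $\mathfrak R_1$ with respect to $L$. (iv) If $K$ is in $\mathfrak R_2$ with respect to $L$, then, for every $t\ge 0$, $K+tL$ is in $\mathfrak R_2$ with respect to $L$. -/

import Mathlib

open MeasureTheory
open scoped Pointwise

noncomputable section

/-- `p` is the relative Steiner polynomial of `K` with respect to `L`: a polynomial of degree at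
most `n` such that `V(K + tL) = p(t)` for all `t ≥ 0`. -/
def IsSteinerPolynomial {n : ℕ} (K L : ConvexBody (EuclideanSpace ℝ (Fin n)))
    (p : Polynomial ℝ) : Prop :=
  p.natDegree ≤ n ∧ ∀ t : ℝ, 0 ≤ t →
    (volume ((K + t • L : ConvexBody (EuclideanSpace ℝ (Fin n))) :
      Set (EuclideanSpace ℝ (Fin n)))).toReal = p.eval t

/-- There is at most one relative Steiner polynomial. -/
theorem IsSteinerPolynomial.unique {n : ℕ} {K L : ConvexBody (EuclideanSpace ℝ (Fin n))}
    {p q : Polynomial ℝ} (hp : IsSteinerPolynomial K L p) (hq : IsSteinerPolynomial K L q) :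
    p = q :=
  Polynomial.eq_of_infinite_eval_eq p q <| (Set.Ici_infinite (0 : ℝ)).mono fun t ht =>
    (hp.2 t ht).symm.trans (hq.2 t ht)

open Classical in
/-- The relative Steiner polynomial of `K` with respect to `L`. (One always exists, by Steiner's
formula, so the value `0` is only there to make the definition total.) -/
def steinerPolynomial {n : ℕ} (K L : ConvexBody (EuclideanSpace ℝ (Fin n))) : Polynomial ℝ :=
  if h : ∃ p, IsSteinerPolynomial K L p then h.choose else 0

/-- The relative quermassintegral `W_i(K, L)`, `0 ≤ i ≤ n`, i.e. the `i`-th normalized coefficient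
in `V(K + tL) = ∑ i, (n choose i) W_i(K, L) t ^ i`. -/
def quermassintegral {n : ℕ} (i : ℕ) (K L : ConvexBody (EuclideanSpace ℝ (Fin n))) : ℝ :=
  (steinerPolynomial K L).coeff i / (n.choose i : ℝ)

/-- The `i`-th relative Bonnesen function
`B_{i;K,L}(r) = 2 W_{i+1}(K,L) r - W_i(K,L) - W_{i+2}(K,L) r ^ 2`, for `i + 2 ≤ n`. -/
def bonnesen {n : ℕ} (i : ℕ) (K L : ConvexBody (EuclideanSpace ℝ (Fin n))) (r : ℝ) : ℝ :=
  2 * quermassintegral (i + 1) K L * r - quermassintegral i K L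
    - quermassintegral (i + 2) K L * r ^ 2

/-- `r_x(K, L) = max {t ≥ 0 | x + tL ⊆ K}`. -/
def innerRadius {n : ℕ} (x : EuclideanSpace ℝ (Fin n))
    (K L : ConvexBody (EuclideanSpace ℝ (Fin n))) : ℝ :=
  sSup {t : ℝ | 0 ≤ t ∧ x +ᵥ t • (L : Set (EuclideanSpace ℝ (Fin n))) ⊆ K}

/-- `R_x(K, L) = min {t > 0 | K ⊆ x + tL}`. -/
def outerRadius {n : ℕ} (x : EuclideanSpace ℝ (Fin n))
    (K L : ConvexBody (EuclideanSpace ℝ (Fin n))) : ℝ :=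
  sInf {t : ℝ | 0 < t ∧ (K : Set (EuclideanSpace ℝ (Fin n))) ⊆ x +ᵥ t • (L : Set _)}

/-- `K` is in the class `R₁ (Fraktur R)` with respect to `L`. -/
def IsInClassOne (K L : ConvexBody (EuclideanSpace ℝ (Fin 3))) : Prop :=
  (0 : EuclideanSpace ℝ (Fin 3)) ∈ interior ((K : Set (EuclideanSpace ℝ (Fin 3))) ∩ L) ∧
    ∀ r ∈ Set.Icc (innerRadius 0 K L) (outerRadius 0 K L), 0 ≤ bonnesen 0 K L r

/-- `K` is in the class `R₂ (Fraktur R)` with respect to `L`. -/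
def IsInClassTwo (K L : ConvexBody (EuclideanSpace ℝ (Fin 3))) : Prop :=
  (0 : EuclideanSpace ℝ (Fin 3)) ∈ interior ((K : Set (EuclideanSpace ℝ (Fin 3))) ∩ L) ∧
    ∀ r ∈ Set.Icc (innerRadius 0 K L) (outerRadius 0 K L), 0 ≤ bonnesen 1 K L r

end

/-!
The four implications are algebra once Steiner's formula `V(K + tL) = ∑ (3 choose i) W_i(K, L) t ^ i`
is known. From `V(L + tK) = t ^ 3 V(K + t⁻¹ L)` follows `W_i(L, K) = W_{3 - i}(K, L)`
(`quermassintegral_swap`), so exchanging `K` and `L` turns one Bonnesen function into the other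
evaluated at `r⁻¹`, and the radii are inverted as well. Replacing `K` by `K + tL` shifts the Steiner
polynomial (`quermassintegral_add_smul`), which gives `B₁(K + tL)(r + t) = B₁(K)(r)` and
`B₀(K + tL)(r + t) = B₀(K)(r) + t B₁(K)(r)`, while both radii increase by `t`; the latter needs the
cancellation law for Minkowski sums (`subset_of_add_subset_add`).

The substance is the existence of the Steiner polynomial (`exists_isSteinerPolynomial`). For a
finite set `A` let `f_A(x) = log ∑ a ∈ A, exp ⟪a, x⟫`, a smooth convex function. If `conv A` has
interior points, then for `t ≥ 0` the gradient of `f_A + t f_B` is injective, with values in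
`conv A + t conv B`, and it attains every interior point of this set, since `f_A + t f_B` minus the
corresponding linear form is coercive. By the change of variables formula the volume of
`conv A + t conv B` is the integral of `det (Hess f_A + t Hess f_B)`, whose integrand is nonnegative
and polynomial in `t` of degree at most the dimension. General bodies are approximated by polytopes,
and a pointwise limit of polynomials of bounded degree is again one, by Lagrange interpolation.
-/

/-! ### The log-sum-exp function of a finite set -/

section LogSumExp

variable {E : Type*} [NormedAddCommGroup E] [InnerProductSpace ℝ E]

/-- The exponential sum `∑ a ∈ A, exp ⟪a, x⟫`. -/
noncomputable def expSum (A : Finset E) (x : E) : ℝ :=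
  ∑ a ∈ A, Real.exp (inner ℝ a x)

/-- The function `x ↦ log ∑ a ∈ A, exp ⟪a, x⟫`, a smooth approximation from above of the support
function of `A`. -/
noncomputable def logSumExp (A : Finset E) (x : E) : ℝ :=
  Real.log (expSum A x)

/-- The mean of `A` with weights proportional to `exp ⟪a, x⟫`; it is the gradient of
`logSumExp A` at `x`. -/
noncomputable def tiltedMean (A : Finset E) (x : E) : E :=
  (expSum A x)⁻¹ • ∑ a ∈ A, Real.exp (inner ℝ a x) • a

/-- The covariance operator of `A` with weights proportional to `exp ⟪a, x⟫`; it is the derivative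
of `tiltedMean A` at `x`, i.e. the Hessian of `logSumExp A`. -/
noncomputable def tiltedCovariance (A : Finset E) (x : E) : E →L[ℝ] E :=
  (expSum A x)⁻¹ • ∑ a ∈ A, Real.exp (inner ℝ a x) • (innerSL ℝ a).smulRight a -
    (innerSL ℝ (tiltedMean A x)).smulRight (tiltedMean A x)

theorem expSum_pos {A : Finset E} (hA : A.Nonempty) (x : E) : 0 < expSum A x :=
  Finset.sum_pos (fun _ _ => Real.exp_pos _) hA

theorem hasFDerivAt_exp_inner (a x : E) :
    HasFDerivAt (fun x => Real.exp (inner ℝ a x)) (Real.exp (inner ℝ a x) • innerSL ℝ a) x :=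
  (innerSL ℝ a).hasFDerivAt.exp

theorem hasFDerivAt_expSum (A : Finset E) (x : E) :
    HasFDerivAt (expSum A) (∑ a ∈ A, Real.exp (inner ℝ a x) • innerSL ℝ a) x :=
  HasFDerivAt.fun_sum fun a _ => hasFDerivAt_exp_inner a x

theorem sum_exp_smul_innerSL {A : Finset E} (hA : A.Nonempty) (x : E) :
    ∑ a ∈ A, Real.exp (inner ℝ a x) • innerSL ℝ a = expSum A x • innerSL ℝ (tiltedMean A x) := by
  rw [tiltedMean, map_smul, smul_inv_smul₀ (expSum_pos hA x).ne', map_sum]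
  simp

theorem hasFDerivAt_logSumExp {A : Finset E} (hA : A.Nonempty) (x : E) :
    HasFDerivAt (logSumExp A) (innerSL ℝ (tiltedMean A x)) x := by
  have h := (hasFDerivAt_expSum A x).log (expSum_pos hA x).ne'
  rwa [sum_exp_smul_innerSL hA, inv_smul_smul₀ (expSum_pos hA x).ne'] at h

theorem hasFDerivAt_tiltedMean {A : Finset E} (hA : A.Nonempty) (x : E) :
    HasFDerivAt (tiltedMean A) (tiltedCovariance A x) x := by
  have h1 : HasFDerivAt (fun x => ∑ a ∈ A, Real.exp (inner ℝ a x) • a)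
      (∑ a ∈ A, Real.exp (inner ℝ a x) • (innerSL ℝ a).smulRight a) x := by
    refine HasFDerivAt.fun_sum fun a _ => ?_
    refine ((hasFDerivAt_exp_inner a x).smul_const a).congr_fderiv ?_
    ext v
    simp [smul_smul]
  have h2 : HasFDerivAt (fun x => (expSum A x)⁻¹)
      (-((expSum A x)⁻¹ • innerSL ℝ (tiltedMean A x))) x := by
    have h := (hasFDerivAt_inv (expSum_pos hA x).ne').comp x (hasFDerivAt_expSum A x)
    rw [sum_exp_smul_innerSL hA] at h
    refine h.congr_fderiv ?_
    ext v
    have := (expSum_pos hA x).ne'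
    simp
    field_simp
  refine (h2.smul h1).congr_fderiv ?_
  ext v
  simp only [tiltedCovariance, tiltedMean, sub_eq_add_neg]
  simp [smul_smul, mul_comm, mul_assoc]

theorem inner_tiltedCovariance (A : Finset E) (x v w : E) :
    inner ℝ (tiltedCovariance A x v) w =
      (expSum A x)⁻¹ * ∑ a ∈ A, Real.exp (inner ℝ a x) * (inner ℝ a v * inner ℝ a w) -
        inner ℝ (tiltedMean A x) v * inner ℝ (tiltedMean A x) w := by
  simp [tiltedCovariance, inner_sub_left, inner_smul_left, sum_inner]

theorem inner_tiltedMean (A : Finset E) (x w : E) :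
    inner ℝ (tiltedMean A x) w =
      (expSum A x)⁻¹ * ∑ a ∈ A, Real.exp (inner ℝ a x) * inner ℝ a w := by
  simp [tiltedMean, inner_smul_left, sum_inner]

theorem isPositive_tiltedCovariance {A : Finset E} (hA : A.Nonempty) (x : E) :
    ((tiltedCovariance A x : E →L[ℝ] E) : E →ₗ[ℝ] E).IsPositive := by
  rw [LinearMap.isPositive_iff]
  refine ⟨fun v w => ?_, fun v => ?_⟩
  · rw [real_inner_comm _ v]
    simp only [ContinuousLinearMap.coe_coe, inner_tiltedCovariance, mul_comm]
  · have hZ := expSum_pos hA x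
    simp only [ContinuousLinearMap.coe_coe, inner_tiltedCovariance, inner_tiltedMean, sub_nonneg]
    have hcs := Finset.sum_sq_le_sum_mul_sum_of_sq_le_mul A
      (r := fun a => Real.exp (inner ℝ a x) * inner ℝ a v)
      (f := fun a => Real.exp (inner ℝ a x))
      (g := fun a => Real.exp (inner ℝ a x) * (inner ℝ a v * inner ℝ a v))
      (fun a _ => (Real.exp_pos _).le)
      (fun a _ => mul_nonneg (Real.exp_pos _).le (mul_self_nonneg _))
      (fun a _ => le_of_eq (by ring))
    change _ ≤ expSum A x * _ at hcs
    calc _ = (expSum A x)⁻¹ ^ 2 * (∑ a ∈ A, Real.exp (inner ℝ a x) * inner ℝ a v) ^ 2 := by ring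
      _ ≤ (expSum A x)⁻¹ ^ 2 *
          (expSum A x * ∑ a ∈ A, Real.exp (inner ℝ a x) * (inner ℝ a v * inner ℝ a v)) := by
        gcongr
      _ = _ := by field_simp

theorem tiltedMean_mem_convexHull {A : Finset E} (hA : A.Nonempty) (x : E) :
    tiltedMean A x ∈ convexHull ℝ (A : Set E) :=
  A.centerMass_mem_convexHull (w := fun a => Real.exp (inner ℝ a x)) (z := id)
    (fun _ _ => (Real.exp_pos _).le) (expSum_pos hA x) fun _ ha => ha

/-- `logSumExp A` dominates the support function of the convex hull of `A`. -/
theorem inner_le_logSumExp {A : Finset E} {u : E} (hu : u ∈ convexHull ℝ (A : Set E)) (x : E) :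
    inner ℝ u x ≤ logSumExp A x := by
  have hconv : Convex ℝ {u : E | inner ℝ u x ≤ logSumExp A x} := by
    simp only [real_inner_comm]
    exact convex_halfSpace_le (innerSL ℝ x).isLinear _
  refine convexHull_min (fun a ha => ?_) hconv hu
  rw [Set.mem_ofPred_eq, logSumExp, Real.le_log_iff_exp_le (expSum_pos ⟨a, ha⟩ x)]
  exact Finset.single_le_sum (f := fun a => Real.exp (inner ℝ a x))
    (fun _ _ => (Real.exp_pos _).le) ha

/-- The difference of the tilted means at `x` and `y`, cleared of denominators, as a double sum of
products of factors of equal sign (as in Chebyshev's sum inequality). -/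
theorem two_mul_inner_tiltedMean_sub {A : Finset E} (hA : A.Nonempty) (x y : E) :
    2 * (expSum A x * expSum A y * inner ℝ (tiltedMean A x - tiltedMean A y) (x - y)) =
      ∑ a ∈ A, ∑ b ∈ A, Real.exp (inner ℝ a y) * Real.exp (inner ℝ b y) *
        ((Real.exp (inner ℝ a (x - y)) - Real.exp (inner ℝ b (x - y))) *
          (inner ℝ a (x - y) - inner ℝ b (x - y))) := by
  have hx := (expSum_pos hA x).ne'
  have hy := (expSum_pos hA y).ne'
  have h1 : expSum A x * expSum A y * inner ℝ (tiltedMean A x - tiltedMean A y) (x - y) =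
      ∑ a ∈ A, ∑ b ∈ A, Real.exp (inner ℝ a x) * Real.exp (inner ℝ b y) *
        (inner ℝ a (x - y) - inner ℝ b (x - y)) := by
    rw [inner_sub_left, inner_tiltedMean, inner_tiltedMean]
    have : ∀ P Q : ℝ, expSum A x * expSum A y * ((expSum A x)⁻¹ * P - (expSum A y)⁻¹ * Q) =
        P * expSum A y - expSum A x * Q := fun P Q => by field_simp
    rw [this, expSum, expSum, Finset.sum_mul_sum, Finset.sum_mul_sum, ← Finset.sum_sub_distrib]
    refine Finset.sum_congr rfl fun a _ => ?_
    rw [← Finset.sum_sub_distrib]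
    exact Finset.sum_congr rfl fun b _ => by ring
  have h2 := h1.trans Finset.sum_comm
  rw [two_mul]
  nth_rw 1 [h1]
  rw [h2, ← Finset.sum_add_distrib]
  refine Finset.sum_congr rfl fun a _ => ?_
  rw [← Finset.sum_add_distrib]
  refine Finset.sum_congr rfl fun b _ => ?_
  have hexp : ∀ c : E, Real.exp (inner ℝ c x) =
      Real.exp (inner ℝ c y) * Real.exp (inner ℝ c (x - y)) := fun c => by
    rw [← Real.exp_add, ← inner_add_right, add_sub_cancel]
  rw [hexp a, hexp b]
  ring

theorem exp_sub_exp_mul_sub_nonneg (c d : ℝ) : 0 ≤ (Real.exp c - Real.exp d) * (c - d) := by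
  rcases le_total c d with h | h
  · exact mul_nonneg_of_nonpos_of_nonpos (sub_nonpos.2 (Real.exp_le_exp.2 h)) (sub_nonpos.2 h)
  · exact mul_nonneg (sub_nonneg.2 (Real.exp_le_exp.2 h)) (sub_nonneg.2 h)

theorem inner_tiltedMean_sub_nonneg {A : Finset E} (hA : A.Nonempty) (x y : E) :
    0 ≤ inner ℝ (tiltedMean A x - tiltedMean A y) (x - y) := by
  have h : 0 ≤ 2 * (expSum A x * expSum A y *
      inner ℝ (tiltedMean A x - tiltedMean A y) (x - y)) := by
    rw [two_mul_inner_tiltedMean_sub hA]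
    exact Finset.sum_nonneg fun a _ => Finset.sum_nonneg fun b _ =>
      mul_nonneg (by positivity) (exp_sub_exp_mul_sub_nonneg _ _)
  exact nonneg_of_mul_nonneg_right (nonneg_of_mul_nonneg_right h two_pos)
    (mul_pos (expSum_pos hA x) (expSum_pos hA y))

/-- A finite set whose convex hull has interior points is not contained in a hyperplane. -/
theorem exists_inner_ne {A : Finset E}
    (hA : (interior (convexHull ℝ (A : Set E))).Nonempty) {d : E} (hd : d ≠ 0) :
    ∃ a ∈ A, ∃ b ∈ A, inner ℝ a d ≠ inner ℝ b d := by
  by_contra! hcon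
  obtain ⟨p, hp⟩ := hA
  have hne : A.Nonempty := by
    have := convexHull_nonempty_iff.1 ⟨p, interior_subset hp⟩
    simpa using this
  obtain ⟨a, ha⟩ := hne
  have hsub : convexHull ℝ (A : Set E) ⊆ {u : E | inner ℝ u d = inner ℝ a d} := by
    refine convexHull_min (fun b hb => hcon b hb a ha) ?_
    simp only [real_inner_comm]
    exact convex_hyperplane (innerSL ℝ d).isLinear _
  have hnhds : ∀ᶠ s : ℝ in nhds 0, p + s • d ∈ interior (convexHull ℝ (A : Set E)) := by
    have hc : Continuous fun s : ℝ => p + s • d := by fun_prop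
    exact hc.continuousAt.eventually (isOpen_interior.mem_nhds (by simpa using hp))
  obtain ⟨s, hs, hs0⟩ := ((hnhds.filter_mono nhdsWithin_le_nhds).and
    (self_mem_nhdsWithin : {0}ᶜ ∈ nhdsWithin (0 : ℝ) {0}ᶜ)).exists
  have h1 := hsub (interior_subset hs)
  have h2 := hsub (interior_subset hp)
  simp only [Set.mem_ofPred_eq, inner_add_left, inner_smul_left] at h1 h2
  rw [h2, add_eq_left] at h1
  simp [hd] at h1
  exact hs0 h1

theorem inner_tiltedMean_sub_pos {A : Finset E}
    (hA : (interior (convexHull ℝ (A : Set E))).Nonempty) {x y : E} (hxy : x ≠ y) :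
    0 < inner ℝ (tiltedMean A x - tiltedMean A y) (x - y) := by
  obtain ⟨a, ha, b, hb, hab⟩ := exists_inner_ne hA (sub_ne_zero.2 hxy)
  have h : 0 < 2 * (expSum A x * expSum A y *
      inner ℝ (tiltedMean A x - tiltedMean A y) (x - y)) := by
    rw [two_mul_inner_tiltedMean_sub ⟨a, ha⟩]
    refine Finset.sum_pos' (fun a _ => Finset.sum_nonneg fun b _ =>
      mul_nonneg (by positivity) (exp_sub_exp_mul_sub_nonneg _ _)) ⟨a, ha, ?_⟩
    refine Finset.sum_pos' (fun b _ =>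
      mul_nonneg (by positivity) (exp_sub_exp_mul_sub_nonneg _ _)) ⟨b, hb, ?_⟩
    refine mul_pos (by positivity) ((exp_sub_exp_mul_sub_nonneg _ _).lt_of_ne' ?_)
    exact mul_ne_zero (sub_ne_zero.2 (Real.exp_injective.ne hab)) (sub_ne_zero.2 hab)
  exact pos_of_mul_pos_right (pos_of_mul_pos_right h two_pos.le)
    (mul_pos (expSum_pos ⟨a, ha⟩ x) (expSum_pos ⟨a, ha⟩ y)).le

end LogSumExp

/-! ### The volume of a Minkowski combination of two polytopes -/

section Polytope

variable {E : Type*} [NormedAddCommGroup E] [InnerProductSpace ℝ E] [FiniteDimensional ℝ E]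

omit [FiniteDimensional ℝ E] in
theorem isCompact_convexHull_add_smul (A B : Finset E) (t : ℝ) :
    IsCompact (convexHull ℝ (A : Set E) + t • convexHull ℝ (B : Set E)) :=
  (A.finite_toSet.isCompact_convexHull ℝ).add ((B.finite_toSet.isCompact_convexHull ℝ).smul t)

theorem LinearMap.IsPositive.zero_le_det {T : E →ₗ[ℝ] E} (hT : T.IsPositive) :
    0 ≤ LinearMap.det T := by
  rw [← LinearMap.det_toMatrix (stdOrthonormalBasis ℝ E).toBasis]
  exact ((LinearMap.posSemidef_toMatrix_iff _).2 hT).det_nonneg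

theorem exists_polynomial_eval_eq_det (M N : E →ₗ[ℝ] E) :
    ∃ p : Polynomial ℝ, p.natDegree ≤ Module.finrank ℝ E ∧
      ∀ t : ℝ, p.eval t = LinearMap.det (M + t • N) := by
  let b := Module.finBasis ℝ E
  refine ⟨_, (Polynomial.natDegree_det_X_add_C_le (LinearMap.toMatrix b b N)
    (LinearMap.toMatrix b b M)).trans_eq (Fintype.card_fin _), fun t => ?_⟩
  rw [← LinearMap.det_toMatrix b, ← Polynomial.coe_evalRingHom, RingHom.map_det]
  congr 1
  ext i j
  simp [add_comm (LinearMap.toMatrix b b M i j), mul_comm t]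

/-- Lagrange interpolation at the nodes `0, 1, …, d`. -/
theorem Polynomial.eval_eq_sum_lagrange {p : Polynomial ℝ} {d : ℕ} (hp : p.natDegree ≤ d) (t : ℝ) :
    p.eval t = ∑ i ∈ Finset.range (d + 1),
      p.eval (i : ℝ) * (Lagrange.basis (Finset.range (d + 1)) (fun i : ℕ => (i : ℝ)) i).eval t := by
  have hdeg : p.degree < (Finset.range (d + 1)).card := by
    rw [Finset.card_range]
    exact (Polynomial.degree_le_of_natDegree_le hp).trans_lt (by exact_mod_cast Nat.lt_succ_self d)
  conv_lhs => rw [Lagrange.eq_interpolate (v := fun i : ℕ => (i : ℝ))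
    (Nat.cast_injective.injOn) hdeg]
  simp [Lagrange.interpolate_apply, Polynomial.eval_finsetSum]

/-- Every interior point of `conv A + t conv B` is a value of the gradient of
`logSumExp A + t logSumExp B`: this function minus the linear form given by the point is coercive,
and its gradient vanishes at a minimum. -/
theorem interior_subset_range_tiltedMean {A B : Finset E} (hA : A.Nonempty) (hB : B.Nonempty)
    {t : ℝ} (ht : 0 ≤ t) :
    interior (convexHull ℝ (A : Set E) + t • convexHull ℝ (B : Set E)) ⊆
      Set.range fun x => tiltedMean A x + t • tiltedMean B x := by
  intro p hp
  obtain ⟨δ, hδ, hball⟩ := Metric.isOpen_iff.1 isOpen_interior p hp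
  let g : E → ℝ := fun x => logSumExp A x + t * logSumExp B x - inner ℝ p x
  have hg : ∀ x, HasFDerivAt g
      (innerSL ℝ (tiltedMean A x) + t • innerSL ℝ (tiltedMean B x) - innerSL ℝ p) x := fun x =>
    ((hasFDerivAt_logSumExp hA x).add ((hasFDerivAt_logSumExp hB x).const_mul t)).sub
      (innerSL ℝ p).hasFDerivAt
  have hbound : ∀ x, δ / 2 * ‖x‖ ≤ g x := by
    intro x
    have hmem : p + (δ / 2) • (‖x‖⁻¹ • x) ∈ Metric.ball p δ := by
      rw [mem_ball_iff_norm, add_sub_cancel_left, norm_smul, norm_smul, norm_inv, norm_norm,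
        Real.norm_of_nonneg (by positivity)]
      have : ‖x‖⁻¹ * ‖x‖ ≤ 1 := inv_mul_le_one
      nlinarith
    obtain ⟨u, hu, w, hw, huw⟩ := Set.mem_add.1 (interior_subset (hball hmem))
    obtain ⟨v, hv, rfl⟩ := hw
    have h := congrArg (fun y => inner ℝ y x) huw
    have hxx : ‖x‖⁻¹ * (‖x‖ * ‖x‖) = ‖x‖ := by
      rcases eq_or_ne ‖x‖ 0 with h0 | h0
      · simp [h0]
      · field_simp
    simp only [inner_add_left, inner_smul_left, conj_trivial, real_inner_self_eq_norm_mul_norm,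
      hxx] at h
    have h1 := inner_le_logSumExp hu x
    have h2 := mul_le_mul_of_nonneg_left (inner_le_logSumExp hv x) ht
    simp only [g]
    linarith
  have hlim : Filter.Tendsto g (Filter.cocompact E) Filter.atTop :=
    Filter.tendsto_atTop_mono hbound
      ((tendsto_norm_cocompact_atTop (E := E)).const_mul_atTop (by positivity))
  have hcont : Continuous g := continuous_iff_continuousAt.2 fun x => (hg x).continuousAt
  obtain ⟨x, hx⟩ := hcont.exists_forall_le hlim
  have hmin : IsLocalMin g x := Filter.Eventually.of_forall hx
  have h0 := hmin.hasFDerivAt_eq_zero (hg x)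
  refine ⟨x, ?_⟩
  rw [← map_smul, ← map_add, ← map_sub] at h0
  have h1 : innerSL ℝ (tiltedMean A x + t • tiltedMean B x - p) = innerSL ℝ 0 := by
    rw [h0, map_zero]
  exact sub_eq_zero.1 (innerSL_inj.1 h1)

omit [FiniteDimensional ℝ E] in
theorem injective_tiltedMean_add {A B : Finset E}
    (hA : (interior (convexHull ℝ (A : Set E))).Nonempty) (hB : B.Nonempty) {t : ℝ} (ht : 0 ≤ t) :
    Function.Injective fun x => tiltedMean A x + t • tiltedMean B x := by
  intro x y hxy
  by_contra hne
  have h1 := inner_tiltedMean_sub_pos hA hne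
  have h2 := mul_nonneg ht (inner_tiltedMean_sub_nonneg hB x y)
  have h3 : (tiltedMean A x - tiltedMean A y) + t • (tiltedMean B x - tiltedMean B y) = 0 := by
    rw [smul_sub, sub_add_sub_comm]
    exact sub_eq_zero.2 hxy
  have h4 := congrArg (fun z => inner ℝ z (x - y)) h3
  simp only [inner_add_left, inner_smul_left, conj_trivial, inner_zero_left] at h4
  linarith

variable [MeasurableSpace E] [BorelSpace E] (μ : Measure E) [μ.IsAddHaarMeasure]

/-- The gradient of `logSumExp A + t logSumExp B` maps the space injectively into
`conv A + t conv B`, and onto it up to a null set; the change of variables formula then gives the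
volume of `conv A + t conv B`. -/
theorem lintegral_det_tiltedCovariance {A B : Finset E}
    (hA : (interior (convexHull ℝ (A : Set E))).Nonempty) (hB : B.Nonempty) {t : ℝ} (ht : 0 ≤ t) :
    ∫⁻ x, ENNReal.ofReal |(tiltedCovariance A x + t • tiltedCovariance B x).det| ∂μ =
      μ (convexHull ℝ (A : Set E) + t • convexHull ℝ (B : Set E)) := by
  have hA' : A.Nonempty := by
    simpa using convexHull_nonempty_iff.1 (hA.mono interior_subset)
  have hconv : Convex ℝ (convexHull ℝ (A : Set E) + t • convexHull ℝ (B : Set E)) :=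
    (convex_convexHull ℝ _).add ((convex_convexHull ℝ _).smul t)
  have h := lintegral_abs_det_fderiv_eq_addHaar_image μ MeasurableSet.univ
    (f := fun x => tiltedMean A x + t • tiltedMean B x)
    (fun x _ => ((hasFDerivAt_tiltedMean hA' x).add
      ((hasFDerivAt_tiltedMean hB x).const_smul t)).hasFDerivWithinAt)
    (injective_tiltedMean_add hA hB ht).injOn
  rw [Measure.restrict_univ, Set.image_univ] at h
  rw [h]
  refine le_antisymm (measure_mono ?_) ?_
  · rintro _ ⟨x, rfl⟩
    exact Set.add_mem_add (tiltedMean_mem_convexHull hA' x)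
      (Set.smul_mem_smul_set (tiltedMean_mem_convexHull hB x))
  · refine le_trans ?_ (measure_mono (interior_subset_range_tiltedMean hA' hB ht))
    refine (measure_mono (subset_closure.trans (closure_eq_interior_union_frontier _).le)).trans ?_
    refine (measure_union_le _ _).trans ?_
    rw [hconv.addHaar_frontier μ, add_zero]

theorem integrable_det_tiltedCovariance {A B : Finset E}
    (hA : (interior (convexHull ℝ (A : Set E))).Nonempty) (hB : B.Nonempty) {t : ℝ} (ht : 0 ≤ t) :
    Integrable (fun x => (tiltedCovariance A x + t • tiltedCovariance B x).det) μ ∧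
      ∫ x, (tiltedCovariance A x + t • tiltedCovariance B x).det ∂μ =
        (μ (convexHull ℝ (A : Set E) + t • convexHull ℝ (B : Set E))).toReal := by
  have hA' : A.Nonempty := by
    simpa using convexHull_nonempty_iff.1 (hA.mono interior_subset)
  have hnonneg : ∀ x, 0 ≤ (tiltedCovariance A x + t • tiltedCovariance B x).det := fun x =>
    ((isPositive_tiltedCovariance hA' x).add
      ((isPositive_tiltedCovariance hB x).smul_of_nonneg ht)).zero_le_det
  have hvol := lintegral_det_tiltedCovariance μ hA hB ht
  simp only [abs_of_nonneg (hnonneg _)] at hvol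
  have hmeas : AEStronglyMeasurable
      (fun x => (tiltedCovariance A x + t • tiltedCovariance B x).det) μ := by
    have h := aemeasurable_fderivWithin μ MeasurableSet.univ
      (f := fun x => tiltedMean A x + t • tiltedMean B x)
      (fun x _ => ((hasFDerivAt_tiltedMean hA' x).add
        ((hasFDerivAt_tiltedMean hB x).const_smul t)).hasFDerivWithinAt)
    rw [Measure.restrict_univ] at h
    exact (ContinuousLinearMap.continuous_det.measurable.comp_aemeasurable h).aestronglyMeasurable
  constructor
  · refine ⟨hmeas, ?_⟩
    rw [hasFiniteIntegral_iff_ofReal (Filter.Eventually.of_forall hnonneg), hvol]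
    exact (isCompact_convexHull_add_smul A B t).measure_lt_top
  · rw [integral_eq_lintegral_of_nonneg_ae (Filter.Eventually.of_forall hnonneg) hmeas, hvol]

/-- The volume of `conv A + t conv B` is a polynomial of degree at most the dimension in `t ≥ 0`,
written in Lagrange form. -/
theorem volume_convexHull_add_smul {A B : Finset E}
    (hA : (interior (convexHull ℝ (A : Set E))).Nonempty) (hB : B.Nonempty) {t : ℝ} (ht : 0 ≤ t) :
    (μ (convexHull ℝ (A : Set E) + t • convexHull ℝ (B : Set E))).toReal =
      ∑ i ∈ Finset.range (Module.finrank ℝ E + 1),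
        (μ (convexHull ℝ (A : Set E) + (i : ℝ) • convexHull ℝ (B : Set E))).toReal *
          (Lagrange.basis (Finset.range (Module.finrank ℝ E + 1))
            (fun i : ℕ => (i : ℝ)) i).eval t := by
  have hdet : ∀ x, (tiltedCovariance A x + t • tiltedCovariance B x).det =
      ∑ i ∈ Finset.range (Module.finrank ℝ E + 1),
        (tiltedCovariance A x + (i : ℝ) • tiltedCovariance B x).det *
          (Lagrange.basis (Finset.range (Module.finrank ℝ E + 1))
            (fun i : ℕ => (i : ℝ)) i).eval t := by
    intro x
    obtain ⟨p, hp, hpe⟩ := exists_polynomial_eval_eq_det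
      (tiltedCovariance A x : E →ₗ[ℝ] E) (tiltedCovariance B x)
    have h : ∀ s : ℝ, (tiltedCovariance A x + s • tiltedCovariance B x).det = p.eval s :=
      fun s => (hpe s).symm
    simp only [h]
    exact Polynomial.eval_eq_sum_lagrange hp t
  have hint := fun i : ℕ => integrable_det_tiltedCovariance μ hA hB (Nat.cast_nonneg (α := ℝ) i)
  rw [← (integrable_det_tiltedCovariance μ hA hB ht).2]
  simp only [hdet]
  rw [integral_finsetSum _ fun i _ => (hint i).1.mul_const _]
  refine Finset.sum_congr rfl fun i _ => ?_
  rw [integral_mul_const, (hint i).2]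

end Polytope

/-! ### Steiner's formula -/

section Steiner

theorem smul_subset_interior_of_zero_mem {E : Type*} [NormedAddCommGroup E] [NormedSpace ℝ E]
    {K : Set E} (hK : Convex ℝ K) (h0 : (0 : E) ∈ interior K) {c : ℝ} (hc0 : 0 ≤ c) (hc1 : c < 1) :
    c • K ⊆ interior K := by
  rintro _ ⟨x, hx, rfl⟩
  have := hK.combo_interior_self_mem_interior h0 hx (sub_pos.2 hc1) hc0 (by ring)
  simpa using this

/-- A convex body with the origin in its interior contains polytopes that contain any given
smaller dilate of the body. -/
theorem exists_finset_smul_subset_convexHull {E : Type*} [NormedAddCommGroup E] [NormedSpace ℝ E]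
    [FiniteDimensional ℝ E] (K : ConvexBody E) (h0 : (0 : E) ∈ interior (K : Set E))
    {c : ℝ} (hc0 : 0 ≤ c) (hc1 : c < 1) :
    ∃ A : Finset E, (interior (convexHull ℝ (A : Set E))).Nonempty ∧
      c • (K : Set E) ⊆ convexHull ℝ (A : Set E) ∧ convexHull ℝ (A : Set E) ⊆ K := by
  obtain ⟨A, hA1, hA2⟩ := Convex.exists_subset_interior_convexHull_finset_of_isCompact
    (K.convex.smul c) (K.isCompact.smul c)
    (mem_nhdsSet_iff_exists.2 ⟨interior (K : Set E), isOpen_interior,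
      smul_subset_interior_of_zero_mem K.convex h0 hc0 hc1, interior_subset⟩)
  exact ⟨A, (K.nonempty.smul_set).mono hA1, hA1.trans interior_subset, hA2⟩

/-- **Steiner's formula** for convex bodies with the origin in their interiors, obtained from the
case of polytopes by approximation: limits of polynomials of bounded degree are polynomials. -/
theorem exists_isSteinerPolynomial {n : ℕ} (K L : ConvexBody (EuclideanSpace ℝ (Fin n)))
    (hK : (0 : EuclideanSpace ℝ (Fin n)) ∈ interior (K : Set (EuclideanSpace ℝ (Fin n))))
    (hL : (0 : EuclideanSpace ℝ (Fin n)) ∈ interior (L : Set (EuclideanSpace ℝ (Fin n)))) :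
    ∃ p, IsSteinerPolynomial K L p := by
  let c : ℕ → ℝ := fun k => 1 - 1 / ((k : ℝ) + 1)
  have hc0 : ∀ k, 0 ≤ c k := fun k => sub_nonneg.2 (div_le_one_of_le₀ (by simp) (by positivity))
  have hc1 : ∀ k, c k < 1 := fun k => sub_lt_self _ (by positivity)
  have hclim : Filter.Tendsto c Filter.atTop (nhds 1) := by
    simpa [c] using (tendsto_one_div_add_atTop_nhds_zero_nat (𝕜 := ℝ)).const_sub 1
  choose A hAi hA1 hA2 using fun k =>
    exists_finset_smul_subset_convexHull K hK (hc0 k) (hc1 k)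
  choose B hBi hB1 hB2 using fun k =>
    exists_finset_smul_subset_convexHull L hL (hc0 k) (hc1 k)
  have hB : ∀ k, (B k).Nonempty := fun k => by
    simpa using convexHull_nonempty_iff.1 ((hBi k).mono interior_subset)
  let V : ℝ → ℝ := fun t => (volume ((K + t • L : ConvexBody (EuclideanSpace ℝ (Fin n))) :
      Set (EuclideanSpace ℝ (Fin n)))).toReal
  let W : ℕ → ℝ → ℝ := fun k t => (volume (convexHull ℝ
    (A k : Set (EuclideanSpace ℝ (Fin n))) + t • convexHull ℝ (B k : Set _))).toReal
  let ℓ : ℕ → Polynomial ℝ := Lagrange.basis (Finset.range (n + 1)) fun i : ℕ => (i : ℝ)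
  have hW : ∀ k t, 0 ≤ t → W k t = ∑ i ∈ Finset.range (n + 1), W k i * (ℓ i).eval t := by
    intro k t ht
    have h := volume_convexHull_add_smul volume (hAi k) (hB k) ht
    rwa [finrank_euclideanSpace_fin] at h
  have hlim : ∀ t : ℝ, Filter.Tendsto (fun k => W k t) Filter.atTop (nhds (V t)) := by
    intro t
    have hle : ∀ k, W k t ≤ V t := fun k => by
      refine ENNReal.toReal_mono (K + t • L).isCompact.measure_lt_top.ne (measure_mono ?_)
      rw [ConvexBody.coe_add, ConvexBody.coe_smul]
      exact Set.add_subset_add (hA2 k) (Set.smul_set_mono (hB2 k))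
    have hge : ∀ k, c k ^ n * V t ≤ W k t := fun k => by
      have h : c k ^ n * V t = (volume (c k • ((K + t • L : ConvexBody
          (EuclideanSpace ℝ (Fin n))) : Set (EuclideanSpace ℝ (Fin n))))).toReal := by
        rw [Measure.addHaar_smul, finrank_euclideanSpace_fin, ENNReal.toReal_mul,
          abs_of_nonneg (pow_nonneg (hc0 k) n), ENNReal.toReal_ofReal (pow_nonneg (hc0 k) n)]
      rw [h]
      refine ENNReal.toReal_mono (isCompact_convexHull_add_smul _ _ t).measure_lt_top.ne
        (measure_mono ?_)
      rw [ConvexBody.coe_add, ConvexBody.coe_smul, smul_add, smul_comm]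
      exact Set.add_subset_add (hA1 k) (Set.smul_set_mono (hB1 k))
    have h1 : Filter.Tendsto (fun k => c k ^ n * V t) Filter.atTop (nhds (V t)) := by
      simpa using (hclim.pow n).mul_const (V t)
    exact tendsto_of_tendsto_of_tendsto_of_le_of_le h1 tendsto_const_nhds hge hle
  refine ⟨∑ i ∈ Finset.range (n + 1), Polynomial.C (V i) * ℓ i, ?_, fun t ht => ?_⟩
  · refine Polynomial.natDegree_sum_le_of_forall_le _ _ fun i hi => ?_
    refine (Polynomial.natDegree_C_mul_le _ _).trans (Polynomial.natDegree_le_of_degree_le ?_)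
    rw [Lagrange.degree_basis Nat.cast_injective.injOn hi, Finset.card_range, Nat.add_sub_cancel]
  · have h : Filter.Tendsto (fun k => W k t) Filter.atTop
        (nhds (∑ i ∈ Finset.range (n + 1), V i * (ℓ i).eval t)) := by
      simp only [hW _ t ht]
      exact tendsto_finsetSum _ fun i _ => (hlim i).mul_const _
    rw [Polynomial.eval_finsetSum]
    simp only [Polynomial.eval_mul, Polynomial.eval_C]
    exact tendsto_nhds_unique (hlim t) h

end Steiner

/-! ### Quermassintegrals in dimension three -/

section Quermassintegral

variable {K L : ConvexBody (EuclideanSpace ℝ (Fin 3))}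

theorem volume_add_smul_eq_quermassintegral
    (hK : (0 : EuclideanSpace ℝ (Fin 3)) ∈ interior (K : Set (EuclideanSpace ℝ (Fin 3))))
    (hL : (0 : EuclideanSpace ℝ (Fin 3)) ∈ interior (L : Set (EuclideanSpace ℝ (Fin 3))))
    {t : ℝ} (ht : 0 ≤ t) :
    (volume ((K + t • L : ConvexBody (EuclideanSpace ℝ (Fin 3))) :
      Set (EuclideanSpace ℝ (Fin 3)))).toReal =
      quermassintegral 0 K L + 3 * quermassintegral 1 K L * t +
        3 * quermassintegral 2 K L * t ^ 2 + quermassintegral 3 K L * t ^ 3 := by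
  have hex := exists_isSteinerPolynomial K L hK hL
  have hp : IsSteinerPolynomial K L (steinerPolynomial K L) := by
    rw [steinerPolynomial, dif_pos hex]
    exact hex.choose_spec
  rw [hp.2 t ht, Polynomial.eval_eq_sum_range' (Nat.lt_succ_of_le hp.1)]
  simp only [Finset.sum_range_succ, Finset.sum_range_zero, quermassintegral]
  norm_num [Nat.choose]
  ring

/-- A cubic expression for `V(K + tL)`, valid for `t > 0`, determines the quermassintegrals. -/
theorem quermassintegral_eq_of_volume
    (hK : (0 : EuclideanSpace ℝ (Fin 3)) ∈ interior (K : Set (EuclideanSpace ℝ (Fin 3))))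
    (hL : (0 : EuclideanSpace ℝ (Fin 3)) ∈ interior (L : Set (EuclideanSpace ℝ (Fin 3))))
    {w₀ w₁ w₂ w₃ : ℝ}
    (h : ∀ t : ℝ, 0 < t → (volume ((K + t • L : ConvexBody (EuclideanSpace ℝ (Fin 3))) :
      Set (EuclideanSpace ℝ (Fin 3)))).toReal = w₀ + 3 * w₁ * t + 3 * w₂ * t ^ 2 + w₃ * t ^ 3) :
    quermassintegral 0 K L = w₀ ∧ quermassintegral 1 K L = w₁ ∧
      quermassintegral 2 K L = w₂ ∧ quermassintegral 3 K L = w₃ := by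
  have heq : ∀ t : ℝ, 0 < t → _ = _ := fun t ht =>
    (volume_add_smul_eq_quermassintegral hK hL ht.le).symm.trans (h t ht)
  have h1 := heq 1 (by norm_num)
  have h2 := heq 2 (by norm_num)
  have h3 := heq 3 (by norm_num)
  have h4 := heq 4 (by norm_num)
  refine ⟨?_, ?_, ?_, ?_⟩ <;> linarith

/-- The relation `W_i(L, K) = W_{3 - i}(K, L)`. -/
theorem quermassintegral_swap
    (hK : (0 : EuclideanSpace ℝ (Fin 3)) ∈ interior (K : Set (EuclideanSpace ℝ (Fin 3))))
    (hL : (0 : EuclideanSpace ℝ (Fin 3)) ∈ interior (L : Set (EuclideanSpace ℝ (Fin 3)))) :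
    quermassintegral 0 L K = quermassintegral 3 K L ∧
      quermassintegral 1 L K = quermassintegral 2 K L ∧
      quermassintegral 2 L K = quermassintegral 1 K L ∧
      quermassintegral 3 L K = quermassintegral 0 K L := by
  refine quermassintegral_eq_of_volume hL hK fun t ht => ?_
  have hset : ((L + t • K : ConvexBody (EuclideanSpace ℝ (Fin 3))) :
      Set (EuclideanSpace ℝ (Fin 3))) =
      t • ((K + t⁻¹ • L : ConvexBody (EuclideanSpace ℝ (Fin 3))) : Set _) := by
    rw [ConvexBody.coe_add, ConvexBody.coe_add, ConvexBody.coe_smul, ConvexBody.coe_smul, smul_add,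
      smul_inv_smul₀ ht.ne', add_comm]
  rw [hset, Measure.addHaar_smul, finrank_euclideanSpace_fin, ENNReal.toReal_mul,
    abs_of_pos (pow_pos ht 3), ENNReal.toReal_ofReal (pow_pos ht 3).le,
    volume_add_smul_eq_quermassintegral hK hL (inv_pos.2 ht).le]
  field_simp
  ring

theorem zero_mem_interior_add_smul {n : ℕ} {K L : ConvexBody (EuclideanSpace ℝ (Fin n))}
    (hK : (0 : EuclideanSpace ℝ (Fin n)) ∈ interior (K : Set (EuclideanSpace ℝ (Fin n))))
    (hL : (0 : EuclideanSpace ℝ (Fin n)) ∈ interior (L : Set (EuclideanSpace ℝ (Fin n))))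
    (t : ℝ) : (0 : EuclideanSpace ℝ (Fin n)) ∈ interior
      ((K + t • L : ConvexBody (EuclideanSpace ℝ (Fin n))) : Set (EuclideanSpace ℝ (Fin n))) := by
  refine interior_mono (fun x hx => ?_) hK
  rw [ConvexBody.coe_add, ConvexBody.coe_smul]
  exact ⟨x, hx, 0, ⟨0, interior_subset hL, smul_zero t⟩, add_zero x⟩

/-- The quermassintegrals of `K + tL` relative to `L`: the Taylor shift of the Steiner polynomial. -/
theorem quermassintegral_add_smul
    (hK : (0 : EuclideanSpace ℝ (Fin 3)) ∈ interior (K : Set (EuclideanSpace ℝ (Fin 3))))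
    (hL : (0 : EuclideanSpace ℝ (Fin 3)) ∈ interior (L : Set (EuclideanSpace ℝ (Fin 3))))
    {t : ℝ} (ht : 0 ≤ t) :
    quermassintegral 0 (K + t • L) L = quermassintegral 0 K L + 3 * quermassintegral 1 K L * t +
        3 * quermassintegral 2 K L * t ^ 2 + quermassintegral 3 K L * t ^ 3 ∧
      quermassintegral 1 (K + t • L) L = quermassintegral 1 K L +
        2 * quermassintegral 2 K L * t + quermassintegral 3 K L * t ^ 2 ∧
      quermassintegral 2 (K + t • L) L = quermassintegral 2 K L + quermassintegral 3 K L * t ∧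
      quermassintegral 3 (K + t • L) L = quermassintegral 3 K L := by
  refine quermassintegral_eq_of_volume (zero_mem_interior_add_smul hK hL t) hL fun s hs => ?_
  have hbody : K + t • L + s • L = K + (t + s) • L := by
    refine ConvexBody.ext ?_
    simp only [ConvexBody.coe_add, ConvexBody.coe_smul]
    rw [add_assoc, L.convex.add_smul ht hs.le]
  rw [hbody, volume_add_smul_eq_quermassintegral hK hL (add_nonneg ht hs.le)]
  ring

theorem bonnesen_one_swap
    (hK : (0 : EuclideanSpace ℝ (Fin 3)) ∈ interior (K : Set (EuclideanSpace ℝ (Fin 3))))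
    (hL : (0 : EuclideanSpace ℝ (Fin 3)) ∈ interior (L : Set (EuclideanSpace ℝ (Fin 3))))
    {r : ℝ} (hr : 0 < r) : bonnesen 1 L K r = r ^ 2 * bonnesen 0 K L r⁻¹ := by
  obtain ⟨-, h1, h2, h3⟩ := quermassintegral_swap hK hL
  simp only [bonnesen, Nat.reduceAdd, h1, h2, h3]
  field_simp
  ring

theorem bonnesen_zero_swap
    (hK : (0 : EuclideanSpace ℝ (Fin 3)) ∈ interior (K : Set (EuclideanSpace ℝ (Fin 3))))
    (hL : (0 : EuclideanSpace ℝ (Fin 3)) ∈ interior (L : Set (EuclideanSpace ℝ (Fin 3))))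
    {r : ℝ} (hr : 0 < r) : bonnesen 0 L K r = r ^ 2 * bonnesen 1 K L r⁻¹ := by
  obtain ⟨h0, h1, h2, -⟩ := quermassintegral_swap hK hL
  simp only [bonnesen, Nat.reduceAdd, h0, h1, h2]
  field_simp
  ring

theorem bonnesen_one_add_smul
    (hK : (0 : EuclideanSpace ℝ (Fin 3)) ∈ interior (K : Set (EuclideanSpace ℝ (Fin 3))))
    (hL : (0 : EuclideanSpace ℝ (Fin 3)) ∈ interior (L : Set (EuclideanSpace ℝ (Fin 3))))
    {t : ℝ} (ht : 0 ≤ t) (r : ℝ) :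
    bonnesen 1 (K + t • L) L r = bonnesen 1 K L (r - t) := by
  obtain ⟨-, h1, h2, h3⟩ := quermassintegral_add_smul hK hL ht
  simp only [bonnesen, Nat.reduceAdd, h1, h2, h3]
  ring

theorem bonnesen_zero_add_smul
    (hK : (0 : EuclideanSpace ℝ (Fin 3)) ∈ interior (K : Set (EuclideanSpace ℝ (Fin 3))))
    (hL : (0 : EuclideanSpace ℝ (Fin 3)) ∈ interior (L : Set (EuclideanSpace ℝ (Fin 3))))
    {t : ℝ} (ht : 0 ≤ t) (r : ℝ) :
    bonnesen 0 (K + t • L) L r = bonnesen 0 K L (r - t) + t * bonnesen 1 K L (r - t) := by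
  obtain ⟨h0, h1, h2, -⟩ := quermassintegral_add_smul hK hL ht
  simp only [bonnesen, Nat.reduceAdd, h0, h1, h2]
  ring

end Quermassintegral

/-! ### Inner and outer radii -/

section Radii

/-- The cancellation law for Minkowski sums, by separation of a point of `A` from `B`. -/
theorem subset_of_add_subset_add {E : Type*} [NormedAddCommGroup E] [NormedSpace ℝ E]
    {A B C : Set E} (hBc : Convex ℝ B) (hBcl : IsClosed B) (hC : IsCompact C) (hCne : C.Nonempty)
    (h : A + C ⊆ B + C) : A ⊆ B := by
  intro a ha
  by_contra haB
  obtain ⟨f, u, hfa, hfB⟩ := geometric_hahn_banach_point_closed hBc hBcl haB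
  obtain ⟨c, hc, hmin⟩ := hC.exists_isMinOn hCne f.continuous.continuousOn
  obtain ⟨b, hb, c', hc', hbc⟩ := h (Set.add_mem_add ha hc)
  have h1 := congrArg f hbc
  simp only [map_add] at h1
  have h2 : f c ≤ f c' := hmin hc'
  linarith [hfB b hb]

variable {n : ℕ} {K L : ConvexBody (EuclideanSpace ℝ (Fin n))}

theorem exists_pos_smul_subset
    (hK : (0 : EuclideanSpace ℝ (Fin n)) ∈ interior (K : Set (EuclideanSpace ℝ (Fin n)))) :
    ∃ t : ℝ, 0 < t ∧ t • (L : Set (EuclideanSpace ℝ (Fin n))) ⊆ K := by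
  obtain ⟨ε, hε, hball⟩ := Metric.mem_nhds_iff.1 (mem_interior_iff_mem_nhds.1 hK)
  obtain ⟨M, hM, hLM⟩ := L.isBounded.exists_pos_norm_le
  refine ⟨ε / (2 * M), by positivity, ?_⟩
  rintro _ ⟨x, hx, rfl⟩
  refine hball ?_
  simp only [mem_ball_zero_iff, norm_smul, Real.norm_of_nonneg (show 0 ≤ ε / (2 * M) by positivity)]
  calc ε / (2 * M) * ‖x‖ ≤ ε / (2 * M) * M := by gcongr; exact hLM x hx
    _ = ε / 2 := by field_simp
    _ < ε := half_lt_self hε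

/-- Dilates of a body that is not a point are ordered as their factors, as seen at a point of
maximal norm. -/
theorem le_of_smul_subset_smul [NeZero n]
    (hL : (0 : EuclideanSpace ℝ (Fin n)) ∈ interior (L : Set (EuclideanSpace ℝ (Fin n))))
    {a b : ℝ} (hb : 0 ≤ b)
    (h : a • (L : Set (EuclideanSpace ℝ (Fin n))) ⊆ b • (L : Set (EuclideanSpace ℝ (Fin n)))) :
    a ≤ b := by
  obtain ⟨x, hx, hmax⟩ := L.isCompact.exists_isMaxOn L.nonempty continuous_norm.continuousOn
  have hxpos : 0 < ‖x‖ := by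
    obtain ⟨ε, hε, hball⟩ := Metric.mem_nhds_iff.1 (mem_interior_iff_mem_nhds.1 hL)
    obtain ⟨y, hy⟩ := exists_norm_eq (EuclideanSpace ℝ (Fin n)) (half_pos hε).le
    have hyx : ‖y‖ ≤ ‖x‖ := hmax (hball (by rw [mem_ball_zero_iff, hy]; exact half_lt_self hε))
    linarith
  obtain ⟨y, hy, hyx⟩ := h (Set.smul_mem_smul_set hx)
  have h1 := congrArg norm hyx
  simp only [norm_smul, Real.norm_of_nonneg hb] at h1
  have h2 : ‖y‖ ≤ ‖x‖ := hmax hy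
  refine (le_abs_self a).trans (le_of_mul_le_mul_right ?_ hxpos)
  rw [← Real.norm_eq_abs, ← h1]
  gcongr

theorem innerRadius_zero (K L : ConvexBody (EuclideanSpace ℝ (Fin n))) :
    innerRadius 0 K L = sSup {t : ℝ | 0 ≤ t ∧ t • (L : Set (EuclideanSpace ℝ (Fin n))) ⊆ K} := by
  simp [innerRadius]

theorem outerRadius_zero (K L : ConvexBody (EuclideanSpace ℝ (Fin n))) :
    outerRadius 0 K L =
      sInf {t : ℝ | 0 < t ∧ (K : Set (EuclideanSpace ℝ (Fin n))) ⊆ t • (L : Set _)} := by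
  simp [outerRadius]

theorem isLUB_innerRadius [NeZero n]
    (hK : (0 : EuclideanSpace ℝ (Fin n)) ∈ interior (K : Set (EuclideanSpace ℝ (Fin n))))
    (hL : (0 : EuclideanSpace ℝ (Fin n)) ∈ interior (L : Set (EuclideanSpace ℝ (Fin n)))) :
    IsLUB {t : ℝ | 0 ≤ t ∧ t • (L : Set (EuclideanSpace ℝ (Fin n))) ⊆ K} (innerRadius 0 K L) := by
  rw [innerRadius_zero]
  obtain ⟨t, ht, hsub⟩ := exists_pos_smul_subset (L := L) hK
  obtain ⟨s, hs, hsub'⟩ := exists_pos_smul_subset (L := K) hL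
  refine isLUB_csSup ⟨t, ht.le, hsub⟩ ⟨s⁻¹, fun r hr => ?_⟩
  refine le_of_smul_subset_smul hL (inv_pos.2 hs).le (hr.2.trans ?_)
  rwa [Set.subset_smul_set_iff₀ (inv_pos.2 hs).ne', inv_inv]

theorem isGLB_outerRadius
    (hL : (0 : EuclideanSpace ℝ (Fin n)) ∈ interior (L : Set (EuclideanSpace ℝ (Fin n)))) :
    IsGLB {t : ℝ | 0 < t ∧ (K : Set (EuclideanSpace ℝ (Fin n))) ⊆ t • (L : Set _)}
      (outerRadius 0 K L) := by
  rw [outerRadius_zero]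
  obtain ⟨s, hs, hsub⟩ := exists_pos_smul_subset (L := K) hL
  refine isGLB_csInf ⟨s⁻¹, inv_pos.2 hs, ?_⟩ ⟨0, fun r hr => hr.1.le⟩
  rwa [Set.subset_smul_set_iff₀ (inv_pos.2 hs).ne', inv_inv]

theorem innerRadius_pos [NeZero n]
    (hK : (0 : EuclideanSpace ℝ (Fin n)) ∈ interior (K : Set (EuclideanSpace ℝ (Fin n))))
    (hL : (0 : EuclideanSpace ℝ (Fin n)) ∈ interior (L : Set (EuclideanSpace ℝ (Fin n)))) :
    0 < innerRadius 0 K L := by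
  obtain ⟨t, ht, hsub⟩ := exists_pos_smul_subset (L := L) hK
  exact ht.trans_le ((isLUB_innerRadius hK hL).1 ⟨ht.le, hsub⟩)

theorem outerRadius_swap [NeZero n]
    (hK : (0 : EuclideanSpace ℝ (Fin n)) ∈ interior (K : Set (EuclideanSpace ℝ (Fin n))))
    (hL : (0 : EuclideanSpace ℝ (Fin n)) ∈ interior (L : Set (EuclideanSpace ℝ (Fin n)))) :
    outerRadius 0 L K = (innerRadius 0 K L)⁻¹ := by
  have hpos := innerRadius_pos hK hL
  have hLUB := isLUB_innerRadius hK hL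
  refine (isGLB_outerRadius hK).unique ⟨fun t ht => ?_, fun b hb => ?_⟩
  · refine inv_le_of_inv_le₀ ht.1 (hLUB.1 ⟨(inv_pos.2 ht.1).le, ?_⟩)
    rw [Set.smul_set_subset_iff₀ (inv_pos.2 ht.1).ne', inv_inv]
    exact ht.2
  · rcases le_or_gt b 0 with hb0 | hb0
    · exact hb0.trans (inv_pos.2 hpos).le
    · refine le_inv_of_le_inv₀ hpos (hLUB.2 fun t ht => ?_)
      rcases ht.1.eq_or_lt with rfl | ht0
      · exact (inv_pos.2 hb0).le
      · refine le_inv_of_le_inv₀ hb0 (hb ⟨inv_pos.2 ht0, ?_⟩)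
        rw [Set.subset_smul_set_iff₀ (inv_pos.2 ht0).ne', inv_inv]
        exact ht.2

theorem innerRadius_swap [NeZero n]
    (hK : (0 : EuclideanSpace ℝ (Fin n)) ∈ interior (K : Set (EuclideanSpace ℝ (Fin n))))
    (hL : (0 : EuclideanSpace ℝ (Fin n)) ∈ interior (L : Set (EuclideanSpace ℝ (Fin n)))) :
    innerRadius 0 L K = (outerRadius 0 K L)⁻¹ := by
  rw [outerRadius_swap hL hK, inv_inv]

theorem innerRadius_add_smul [NeZero n]
    (hK : (0 : EuclideanSpace ℝ (Fin n)) ∈ interior (K : Set (EuclideanSpace ℝ (Fin n))))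
    (hL : (0 : EuclideanSpace ℝ (Fin n)) ∈ interior (L : Set (EuclideanSpace ℝ (Fin n))))
    {t : ℝ} (ht : 0 ≤ t) : innerRadius 0 (K + t • L) L = innerRadius 0 K L + t := by
  have hLUB := isLUB_innerRadius hK hL
  refine (isLUB_innerRadius (zero_mem_interior_add_smul hK hL t) hL).unique
    ⟨fun s hs => ?_, fun b hb => ?_⟩
  · rcases le_total s t with hst | hst
    · linarith [innerRadius_pos hK hL]
    · rw [← sub_le_iff_le_add]
      refine hLUB.1 ⟨sub_nonneg.2 hst, subset_of_add_subset_add K.convex K.isClosed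
        (L.isCompact.smul t) L.nonempty.smul_set ?_⟩
      rw [← L.convex.add_smul (sub_nonneg.2 hst) ht, sub_add_cancel]
      simpa using hs.2
  · rw [← le_sub_iff_add_le]
    refine hLUB.2 fun s hs => le_sub_iff_add_le.2 (hb ⟨add_nonneg hs.1 ht, ?_⟩)
    rw [L.convex.add_smul hs.1 ht, ConvexBody.coe_add, ConvexBody.coe_smul]
    exact Set.add_subset_add_right hs.2

theorem outerRadius_add_smul [NeZero n]
    (hK : (0 : EuclideanSpace ℝ (Fin n)) ∈ interior (K : Set (EuclideanSpace ℝ (Fin n))))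
    (hL : (0 : EuclideanSpace ℝ (Fin n)) ∈ interior (L : Set (EuclideanSpace ℝ (Fin n))))
    {t : ℝ} (ht : 0 ≤ t) : outerRadius 0 (K + t • L) L = outerRadius 0 K L + t := by
  have hGLB := isGLB_outerRadius (K := K) hL
  refine (isGLB_outerRadius hL).unique ⟨fun s hs => ?_, fun b hb => ?_⟩
  · have hsub : (K : Set (EuclideanSpace ℝ (Fin n))) + t • (L : Set _) ⊆ s • (L : Set _) := by
      simpa using hs.2
    obtain ⟨ε, hε, hεK⟩ := exists_pos_smul_subset (L := L) hK
    have hts : ε + t ≤ s := by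
      refine le_of_smul_subset_smul hL hs.1.le ?_
      rw [L.convex.add_smul hε.le ht]
      exact (Set.add_subset_add_right hεK).trans hsub
    have hst : 0 < s - t := by linarith
    rw [← le_sub_iff_add_le]
    refine hGLB.1 ⟨hst, subset_of_add_subset_add (L.convex.smul _) (L.isCompact.smul _).isClosed
      (L.isCompact.smul t) L.nonempty.smul_set ?_⟩
    rwa [← L.convex.add_smul hst.le ht, sub_add_cancel]
  · rw [← sub_le_iff_le_add]
    refine hGLB.2 fun s hs => sub_le_iff_le_add.2 (hb ⟨add_pos_of_pos_of_nonneg hs.1 ht, ?_⟩)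
    rw [L.convex.add_smul hs.1.le ht, ConvexBody.coe_add, ConvexBody.coe_smul]
    exact Set.add_subset_add_right hs.2

theorem inv_mem_Icc_radii [NeZero n]
    (hK : (0 : EuclideanSpace ℝ (Fin n)) ∈ interior (K : Set (EuclideanSpace ℝ (Fin n))))
    (hL : (0 : EuclideanSpace ℝ (Fin n)) ∈ interior (L : Set (EuclideanSpace ℝ (Fin n))))
    {r : ℝ} (hr : r ∈ Set.Icc (innerRadius 0 L K) (outerRadius 0 L K)) :
    0 < r ∧ r⁻¹ ∈ Set.Icc (innerRadius 0 K L) (outerRadius 0 K L) := by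
  have hr0 : 0 < r := (innerRadius_pos hL hK).trans_le hr.1
  rw [innerRadius_swap hL hK, outerRadius_swap hL hK]
  exact ⟨hr0, inv_anti₀ hr0 hr.2, inv_anti₀ (innerRadius_pos hL hK) hr.1⟩

theorem sub_mem_Icc_radii [NeZero n]
    (hK : (0 : EuclideanSpace ℝ (Fin n)) ∈ interior (K : Set (EuclideanSpace ℝ (Fin n))))
    (hL : (0 : EuclideanSpace ℝ (Fin n)) ∈ interior (L : Set (EuclideanSpace ℝ (Fin n))))
    {t r : ℝ} (ht : 0 ≤ t)
    (hr : r ∈ Set.Icc (innerRadius 0 (K + t • L) L) (outerRadius 0 (K + t • L) L)) :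
    r - t ∈ Set.Icc (innerRadius 0 K L) (outerRadius 0 K L) := by
  rw [innerRadius_add_smul hK hL ht, outerRadius_add_smul hK hL ht] at hr
  exact ⟨le_sub_iff_add_le.2 hr.1, sub_le_iff_le_add.2 hr.2⟩

end Radii

/-! ### The classes `R₁` and `R₂` -/

theorem corollary2p3 (K L : ConvexBody (EuclideanSpace ℝ (Fin 3)))
    (hK : (interior (K : Set (EuclideanSpace ℝ (Fin 3)))).Nonempty)
    (hL : (interior (L : Set (EuclideanSpace ℝ (Fin 3)))).Nonempty) :
    (IsInClassOne K L → IsInClassTwo L K) ∧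
    (IsInClassTwo K L → IsInClassOne L K) ∧
    (IsInClassOne K L → IsInClassTwo K L → ∀ t : ℝ, 0 ≤ t → IsInClassOne (K + t • L) L) ∧
    (IsInClassTwo K L → ∀ t : ℝ, 0 ≤ t → IsInClassTwo (K + t • L) L) := by
  refine ⟨fun h => ?_, fun h => ?_, fun h h' t ht => ?_, fun h t ht => ?_⟩
  all_goals
    obtain ⟨h0, hB⟩ := h
    have h0' := h0
    rw [interior_inter] at h0'
    obtain ⟨hK0, hL0⟩ := h0'
  · refine ⟨by rwa [Set.inter_comm], fun r hr => ?_⟩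
    obtain ⟨hr0, hr'⟩ := inv_mem_Icc_radii hK0 hL0 hr
    rw [bonnesen_one_swap hK0 hL0 hr0]
    exact mul_nonneg (sq_nonneg r) (hB _ hr')
  · refine ⟨by rwa [Set.inter_comm], fun r hr => ?_⟩
    obtain ⟨hr0, hr'⟩ := inv_mem_Icc_radii hK0 hL0 hr
    rw [bonnesen_zero_swap hK0 hL0 hr0]
    exact mul_nonneg (sq_nonneg r) (hB _ hr')
  · refine ⟨by rw [interior_inter]; exact ⟨zero_mem_interior_add_smul hK0 hL0 t, hL0⟩,
      fun r hr => ?_⟩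
    have hr' := sub_mem_Icc_radii hK0 hL0 ht hr
    rw [bonnesen_zero_add_smul hK0 hL0 ht]
    exact add_nonneg (hB _ hr') (mul_nonneg ht (h'.2 _ hr'))
  · refine ⟨by rw [interior_inter]; exact ⟨zero_mem_interior_add_smul hK0 hL0 t, hL0⟩,
      fun r hr => ?_⟩
    rw [bonnesen_one_add_smul hK0 hL0 ht]
    exact hB _ (sub_mem_Icc_radii hK0 hL0 ht hr)
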